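/- Let \(k\) be a field (of any characteristic), let \(m\ge 6\), and put \(n=3m+1\). Let \(S'=k[a_i,b_i,c_i,d]_{i=1}^m\) be the polynomial ring in \(n\) variables, with the indices \(i\) read modulo \(m\). Let \(P\) be the associated divided power module, that is, the space of \(k\)-linear functionals on \(S'\) that vanish on \((S'_+)^N\) for all \(N\gg 0\), where \(S'_+\) is the ideal generated by the variables. The ring \(S'\) acts on \(P\) by contraction, \((s\cdot f)(t)=f(st)\). For \(f\in P\) let \(\mathrm{Ann}(f)=\{s\in S' : s\cdot f=0\}\) and \(\mathrm{Apolar}(f)=S'/\mathrm{Ann}(f)\). Consider the cubic \[F'=\sum_{i=1}^m \left(a_ib_ic_i+a_ia_{i+1}^2+b_ib_{i+1}^2+c_ic_{i+1}^2+a_ib_{i+1}d\right),\] and denote also by \(F'\) its dual element in \(P\), obtained by replacing each monomial by the element of the dual basis of \(P\) corresponding to it. Then \(F'\) is homogeneous of degree \(3\) in \(P\), and \(\mathrm{Apolar}(F')\) satisfies the small tangent space condition: with \(I=\mathrm{Ann}(F')\), the algebra \(S'/I\) has Hilbert function \((1,n,n,1)\) (and \(0\) in all degrees \(\ge 4\)),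 \(H(S'/I^2)_4=n\), and \(H(S'/I^2)_5=0\). Here \(H(M)_i\) denotes the dimension over \(k\) of the degree \(i\) part of \(M\). -/

import Mathlib

namespace SmallTangent

noncomputable section

open MvPolynomial

/-! ### The divided power module, contraction, apolar algebras -/

section Apolar

variable (σ : Type*) (k : Type*) [Field k]

/-- The divided power module `P` associated with the polynomial ring `S = k[σ]`: the space of
those `k`-linear functionals on `S` that vanish on `(S₊)^N` for all sufficiently large `N`,
where `S₊` is the ideal generated by the variables. -/
def dividedPower : Submodule k (Module.Dual k (MvPolynomial σ k)) where
  carrier := {f | ∃ N₀ : ℕ, ∀ N ≥ N₀, ∀ s ∈ (idealOfVars σ k) ^ N, f s = 0}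
  zero_mem' := ⟨0, fun _ _ _ _ => rfl⟩
  add_mem' := by
    rintro f g ⟨M, hM⟩ ⟨N, hN⟩
    refine ⟨max M N, fun L hL s hs => ?_⟩
    rw [LinearMap.add_apply, hM L (le_of_max_le_left hL) s hs,
      hN L (le_of_max_le_right hL) s hs, add_zero]
  smul_mem' := by
    rintro c f ⟨M, hM⟩
    refine ⟨M, fun L hL s hs => ?_⟩
    rw [LinearMap.smul_apply, hM L hL s hs, smul_zero]

variable {σ k}

/-- Contraction: the action of `S` on `P` given by `(s · f)(t) = f (s * t)`. -/
def contract (s : MvPolynomial σ k) (f : dividedPower σ k) : dividedPower σ k :=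
  ⟨f.1 ∘ₗ LinearMap.mulLeft k s, by
    obtain ⟨N₀, h⟩ := f.2
    exact ⟨N₀, fun N hN t ht => h N hN (s * t) (Ideal.mul_mem_left _ s ht)⟩⟩

/-- The element `x^[a]` of `P` dual to the monomial `α^a`. -/
def dualMonomial (a : σ →₀ ℕ) : dividedPower σ k :=
  ⟨lcoeff k a, a.degree + 1, fun N hN s hs =>
    (mem_pow_idealOfVars_iff' N s).1 hs a (by omega)⟩

/-- The `k`-linear map from `S` to `P` sending each monomial `α^a` to `x^[a]`; it sends a
polynomial to its dual element in the divided power module. -/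
def dualElement : MvPolynomial σ k →ₗ[k] dividedPower σ k :=
  (basisMonomials σ k).constr k dualMonomial

/-- An element of `P` is homogeneous of degree `d` if it is in the span of the `x^[a]` with
`|a| = d`. -/
def IsHomogeneousOfDegree (f : dividedPower σ k) (d : ℕ) : Prop :=
  f ∈ Submodule.span k {g | ∃ a : σ →₀ ℕ, a.degree = d ∧ g = dualMonomial a}

/-- The apolar ideal `Ann(f) = {s ∈ S : s · f = 0}`. -/
def Ann (f : dividedPower σ k) : Ideal (MvPolynomial σ k) where
  carrier := {s | contract s f = 0}
  zero_mem' := by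
    ext t
    simp [contract]
  add_mem' := by
    intro s t hs ht
    have hs' : ∀ u, f.1 (s * u) = 0 := fun u => LinearMap.congr_fun (Subtype.ext_iff.1 hs) u
    have ht' : ∀ u, f.1 (t * u) = 0 := fun u => LinearMap.congr_fun (Subtype.ext_iff.1 ht) u
    refine Subtype.ext (LinearMap.ext fun u => ?_)
    change f.1 ((s + t) * u) = 0
    rw [add_mul, map_add, hs', ht', add_zero]
  smul_mem' := by
    intro c s hs
    have hs' : ∀ u, f.1 (s * u) = 0 := fun u => LinearMap.congr_fun (Subtype.ext_iff.1 hs) u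
    refine Subtype.ext (LinearMap.ext fun u => ?_)
    change f.1 (c * s * u) = 0
    rw [mul_comm c s, mul_assoc, hs']

/-- The apolar algebra `Apolar(f) = S / Ann(f)`. -/
abbrev Apolar (f : dividedPower σ k) : Type _ := MvPolynomial σ k ⧸ Ann f

/-- The degree `i` part of `S / I`, for a homogeneous ideal `I`: the image of the space of
homogeneous polynomials of degree `i`. -/
def gradedPart (I : Ideal (MvPolynomial σ k)) (i : ℕ) : Submodule k (MvPolynomial σ k ⧸ I) :=
  (homogeneousSubmodule σ k i).map (Ideal.Quotient.mkₐ k I).toLinearMap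

/-- The Hilbert function `H(S/I)_i` of `S / I`, for a homogeneous ideal `I` in finitely many
variables. -/
def hilbertFunction (I : Ideal (MvPolynomial σ k)) (i : ℕ) : ℕ :=
  Module.finrank k (gradedPart I i)

/-- The small tangent space condition for `Apolar(f)`, where `f` is a homogeneous element of
degree `3` of the divided power module in the `n` variables `σ`: `f` is homogeneous of degree
`3`, the algebra `S / Ann(f)` has Hilbert function `(1, n, n, 1)`, `H(S / Ann(f)²)_4 = n`, and
`H(S / Ann(f)²)_5 = 0`. -/
structure SmallTangentSpaceCondition [Fintype σ] (f : dividedPower σ k) : Prop where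
  homogeneous : IsHomogeneousOfDegree f 3
  hilbert_zero : hilbertFunction (Ann f) 0 = 1
  hilbert_one : hilbertFunction (Ann f) 1 = Fintype.card σ
  hilbert_two : hilbertFunction (Ann f) 2 = Fintype.card σ
  hilbert_three : hilbertFunction (Ann f) 3 = 1
  hilbert_ge_four : ∀ i, 4 ≤ i → hilbertFunction (Ann f) i = 0
  hilbert_sq_four : hilbertFunction ((Ann f) ^ 2) 4 = Fintype.card σ
  hilbert_sq_five : hilbertFunction ((Ann f) ^ 2) 5 = 0

end Apolar

/-! ### The cubic -/

section Cubic

/-- The `3m + 1` variables `aᵢ, bᵢ, cᵢ, d`, with the index `i` taken modulo `m`. -/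
abbrev Var (m : ℕ) : Type := (Fin 3 × ZMod m) ⊕ Unit

variable (k : Type*) [Field k] (m : ℕ)

/-- The variable `aᵢ`. -/
def a (i : ZMod m) : MvPolynomial (Var m) k := X (Sum.inl (0, i))

/-- The variable `bᵢ`. -/
def b (i : ZMod m) : MvPolynomial (Var m) k := X (Sum.inl (1, i))

/-- The variable `cᵢ`. -/
def c (i : ZMod m) : MvPolynomial (Var m) k := X (Sum.inl (2, i))

/-- The variable `d`. -/
def d : MvPolynomial (Var m) k := X (Sum.inr ())

/-- `F = ∑ᵢ aᵢ bᵢ cᵢ + aᵢ aᵢ₊₁² + bᵢ bᵢ₊₁² + cᵢ cᵢ₊₁²`. -/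
def cubicF [NeZero m] : MvPolynomial (Var m) k :=
  ∑ i : ZMod m, (a k m i * b k m i * c k m i + a k m i * a k m (i + 1) ^ 2
    + b k m i * b k m (i + 1) ^ 2 + c k m i * c k m (i + 1) ^ 2)

/-- `F' = F + ∑ᵢ aᵢ bᵢ₊₁ d`. -/
def cubicF' [NeZero m] : MvPolynomial (Var m) k :=
  cubicF k m + ∑ i : ZMod m, a k m i * b k m (i + 1) * d k m

end Cubic

end

end SmallTangent

/-! In `Apolar(F')` the product of two variables is either zero or the dual, with respect to the
perfect pairing of degrees `1` and `2`, of a single variable; the partial table `third` records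
which. Hence `I = Ann(F')` contains `p = x * y` for every vanishing pair and `p - q` for any two
products `p`, `q` with the same dual. Multiplying two such elements, one gets that modulo `I²`

* `w * x * (y * z)` with `w * x` vanishing only depends on the class of `y * z`, so that regrouping
  different factorizations of this class relates quartics that contain a vanishing pair;
* `p * q = p * q' + p' * q - p' * q'` whenever `p, p'` and `q, q'` are pairs of equal class, which
  reduces the quartics without a vanishing pair to those that contain one.

All quartics are thus spanned by the products `w * aⱼ * bⱼ * cⱼ` with `j` different from the index
of `w`. For fixed `w` the choice of `j` is free, and these `n` classes are linearly independent: the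
functionals `p ↦ F'(∂ᵥ p)` vanish on `I²`, because `∂ᵥ (I²) ⊆ I`, and are dual to them. In degree
`5`, choosing `j` away from the indices of both `v` and `w` makes `v * w * aⱼ * bⱼ * cⱼ` the product
of a vanishing quadric and a cubic of `I`. -/

namespace SmallTangent

open MvPolynomial

section Homogeneous

variable {σ k : Type*} [Field k]

theorem homogeneousSubmodule_zero_eq_span :
    homogeneousSubmodule σ k 0 = Submodule.span k {1} := by
  rw [homogeneousSubmodule_zero, Submodule.one_eq_span]

theorem homogeneousSubmodule_succ_le {N : Submodule k (MvPolynomial σ k)} {n : ℕ}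
    (h : ∀ v, ∀ q ∈ homogeneousSubmodule σ k n, X v * q ∈ N) :
    homogeneousSubmodule σ k (n + 1) ≤ N := by
  rw [← homogeneousSubmodule_one_pow, pow_succ', homogeneousSubmodule_one_pow,
    homogeneousSubmodule_one_eq_span_X, Submodule.mul_le]
  intro p hp q hq
  have : Submodule.span k (Set.range X) ≤ N.comap (LinearMap.mulRight k q) :=
    Submodule.span_le.2 (Set.range_subset_iff.2 fun v ↦ h v q hq)
  exact this hp

open scoped Pointwise in
theorem homogeneousSubmodule_four_le {N : Submodule k (MvPolynomial σ k)}
    (h : ∀ w x y z, X w * X x * (X y * X z) ∈ N) : homogeneousSubmodule σ k 4 ≤ N := by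
  rw [← homogeneousSubmodule_one_pow, homogeneousSubmodule_one_eq_span_X, Submodule.span_pow,
    Submodule.span_le, show 4 = 2 + 2 from rfl, pow_add, pow_two]
  rintro _ ⟨_, ⟨_, ⟨w, rfl⟩, _, ⟨x, rfl⟩, rfl⟩, _, ⟨_, ⟨y, rfl⟩, _, ⟨z, rfl⟩, rfl⟩, rfl⟩
  exact h w x y z

theorem isHomogeneous_X_mul_X (x y : σ) : (X x * X y : MvPolynomial σ k).IsHomogeneous 2 :=
  (isHomogeneous_X k x).mul (isHomogeneous_X k y)

theorem isHomogeneous_X_mul_X_mul_X (x y z : σ) :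
    (X x * (X y * X z) : MvPolynomial σ k).IsHomogeneous 3 :=
  (isHomogeneous_X k x).mul (isHomogeneous_X_mul_X y z)

theorem X_mul_X_mul_X_eq_monomial [DecidableEq σ] (x y z : σ) :
    (X x * (X y * X z) : MvPolynomial σ k) = monomial (Multiset.toFinsupp {x, y, z}) 1 := by
  simp [X, monomial_mul, ← Multiset.singleton_add, Multiset.insert_eq_cons]

end Homogeneous

section DualElement

variable {σ k : Type*} [Field k]

theorem dualElement_monomial (s : σ →₀ ℕ) (r : k) :
    dualElement (monomial s r) = r • dualMonomial s := by
  have h := (basisMonomials σ k).constr_basis k (dualMonomial (k := k)) s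
  rw [coe_basisMonomials] at h
  rw [← mul_one r, ← smul_eq_mul, ← smul_monomial, map_smul, dualElement, h, smul_eq_mul, mul_one]

theorem dualElement_apply_monomial (F : MvPolynomial σ k) (s : σ →₀ ℕ) :
    (dualElement F).1 (monomial s 1) = coeff s F := by
  classical
  induction F using MvPolynomial.induction_on' with
  | monomial t r => simp [dualElement_monomial, dualMonomial, coeff_monomial, eq_comm]
  | add p q hp hq => simp [hp, hq]

theorem isHomogeneousOfDegree_dualElement {F : MvPolynomial σ k} {n : ℕ} (hF : F.IsHomogeneous n) :
    IsHomogeneousOfDegree (dualElement F) n := by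
  rw [F.as_sum, map_sum]
  refine Submodule.sum_mem _ fun s hs ↦ ?_
  rw [dualElement_monomial]
  refine Submodule.smul_mem _ _ (Submodule.subset_span ⟨s, ?_, rfl⟩)
  by_contra hne
  exact mem_support_iff.1 hs (hF.coeff_eq_zero hne)

end DualElement

section Apolar

variable {σ k : Type*} [Field k] {f : dividedPower σ k}

theorem mem_Ann {s : MvPolynomial σ k} : s ∈ Ann f ↔ ∀ t, f.1 (s * t) = 0 :=
  ⟨fun h t ↦ LinearMap.congr_fun (Subtype.ext_iff.1 h) t,
    fun h ↦ Subtype.ext (LinearMap.ext fun t ↦ h t)⟩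

theorem apply_eq_zero_of_isHomogeneous {e n : ℕ} (hf : IsHomogeneousOfDegree f e)
    {p : MvPolynomial σ k} (hp : p.IsHomogeneous n) (hn : n ≠ e) : f.1 p = 0 := by
  induction hf using Submodule.span_induction with
  | mem g hg =>
    obtain ⟨s, rfl, rfl⟩ := hg
    exact hp.coeff_eq_zero hn.symm
  | zero => rfl
  | add g g' _ _ hg hg' => simp [hg, hg']
  | smul c g _ hg => simp [hg]

theorem mem_Ann_of_isHomogeneous {i e : ℕ} (hf : IsHomogeneousOfDegree f e)
    {p : MvPolynomial σ k} (hp : p.IsHomogeneous i)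
    (h : ∀ j, i + j = e → ∀ t ∈ homogeneousSubmodule σ k j, f.1 (p * t) = 0) : p ∈ Ann f := by
  refine mem_Ann.2 fun t ↦ ?_
  rw [← sum_homogeneousComponent t, Finset.mul_sum, map_sum]
  refine Finset.sum_eq_zero fun j _ ↦ ?_
  have ht := homogeneousComponent_isHomogeneous j t
  by_cases hj : i + j = e
  · exact h j hj _ ht
  · exact apply_eq_zero_of_isHomogeneous hf (hp.mul ht) hj

theorem mem_Ann_of_span {ι : Type*} {e i j : ℕ} (hf : IsHomogeneousOfDegree f e) (hij : i + j = e)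
    {p : MvPolynomial σ k} (hp : p.IsHomogeneous i) {q : ι → MvPolynomial σ k}
    (hq : homogeneousSubmodule σ k j = Submodule.span k (Set.range q))
    (h : ∀ v, f.1 (p * q v) = 0) : p ∈ Ann f := by
  refine mem_Ann_of_isHomogeneous hf hp fun j' hj t ht ↦ ?_
  obtain rfl : j' = j := by lia
  have : Submodule.span k (Set.range q) ≤ LinearMap.ker (f.1 ∘ₗ LinearMap.mulLeft k p) :=
    Submodule.span_le.2 (Set.range_subset_iff.2 h)
  exact this (hq ▸ ht)

theorem mem_Ann_of_lt {e i : ℕ} (hf : IsHomogeneousOfDegree f e) (hi : e < i)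
    {p : MvPolynomial σ k} (hp : p.IsHomogeneous i) : p ∈ Ann f :=
  mem_Ann_of_isHomogeneous hf hp fun _ hj ↦ by lia

theorem apply_pderiv_eq_zero_of_mem_sq {p : MvPolynomial σ k} (hp : p ∈ Ann f ^ 2) (v : σ) :
    f.1 (pderiv v p) = 0 := by
  rw [pow_two] at hp
  induction hp using Submodule.mul_induction_on' with
  | mem_mul_mem p hp q hq =>
    simp [Derivation.leibniz, mem_Ann.1 hp, mem_Ann.1 hq]
  | add p _ q _ hp hq => rw [map_add, map_add, hp, hq, add_zero]

end Apolar

section HilbertFunction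

variable {σ k : Type*} [Field k]

theorem hilbertFunction_eq_zero {J : Ideal (MvPolynomial σ k)} {n : ℕ}
    (h : homogeneousSubmodule σ k n ≤ J.restrictScalars k) : hilbertFunction J n = 0 := by
  have : gradedPart J n = ⊥ := by
    rw [eq_bot_iff, gradedPart, Submodule.map_le_iff_le_comap]
    exact fun p hp ↦ Ideal.Quotient.eq_zero_iff_mem.2 (h hp)
  rw [hilbertFunction, this, finrank_bot]

theorem hilbertFunction_eq_card {ι : Type*} [Fintype ι] [DecidableEq ι]
    {J : Ideal (MvPolynomial σ k)} {n : ℕ} {p : ι → MvPolynomial σ k}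
    (hp : ∀ v, p v ∈ homogeneousSubmodule σ k n)
    (hspan : homogeneousSubmodule σ k n ≤ J.restrictScalars k ⊔ Submodule.span k (Set.range p))
    {φ : ι → Module.Dual k (MvPolynomial σ k)} (hφ : ∀ v, ∀ q ∈ J, φ v q = 0)
    (hφp : ∀ v w, φ v (p w) = if v = w then 1 else 0) :
    hilbertFunction J n = Fintype.card ι := by
  have hgraded : gradedPart J n =
      Submodule.span k (Set.range fun v ↦ (Ideal.Quotient.mkₐ k J).toLinearMap (p v)) := by
    have hJ : (J.restrictScalars k).map (Ideal.Quotient.mkₐ k J).toLinearMap = ⊥ := by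
      rw [eq_bot_iff, Submodule.map_le_iff_le_comap]
      exact fun q hq ↦ Ideal.Quotient.eq_zero_iff_mem.2 hq
    rw [Set.range_comp', ← Submodule.map_span]
    refine le_antisymm ?_ (Submodule.map_mono (Submodule.span_le.2 (Set.range_subset_iff.2 hp)))
    refine (Submodule.map_mono hspan).trans ?_
    rw [Submodule.map_sup, hJ, bot_sup_eq]
  rw [hilbertFunction, hgraded]
  refine finrank_span_eq_card (Fintype.linearIndependent_iff.2 fun c hc v ↦ ?_)
  have hmem : ∑ w, c w • p w ∈ J := by
    rw [← Ideal.Quotient.eq_zero_iff_mem, ← hc]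
    exact (map_sum (Ideal.Quotient.mkₐ k J).toLinearMap _ _).trans (by simp only [map_smul])
  simpa [hφp] using hφ v _ hmem

variable {f : dividedPower σ k} {ι : Type*} [Fintype ι] [DecidableEq ι] {e i j : ℕ}
  {p q : ι → MvPolynomial σ k}

theorem hilbertFunction_Ann_left (hf : IsHomogeneousOfDegree f e) (hij : i + j = e)
    (hp : ∀ v, (p v).IsHomogeneous i)
    (hq : homogeneousSubmodule σ k j = Submodule.span k (Set.range q))
    (hpq : ∀ v w, f.1 (p v * q w) = if v = w then 1 else 0) :
    hilbertFunction (Ann f) i = Fintype.card ι := by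
  refine hilbertFunction_eq_card hp (fun r hr ↦ ?_)
    (φ := fun w ↦ f.1 ∘ₗ LinearMap.mulRight k (q w)) (fun w r hr ↦ mem_Ann.1 hr _)
    fun w v ↦ by simp [hpq, eq_comm]
  let s := ∑ w, f.1 (r * q w) • p w
  have hs : s ∈ Submodule.span k (Set.range p) := Submodule.sum_mem _ fun w _ ↦
    Submodule.smul_mem _ _ (Submodule.subset_span ⟨w, rfl⟩)
  have hs_hom : s.IsHomogeneous i := (homogeneousSubmodule σ k i).sum_mem fun w _ ↦
    Submodule.smul_mem _ _ (hp w)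
  have hrs : r - s ∈ Ann f := mem_Ann_of_span hf hij (hr.sub hs_hom) hq fun w ↦ by
    simp [s, sub_mul, Finset.sum_mul, hpq]
  exact Submodule.mem_sup.2 ⟨r - s, hrs, s, hs, sub_add_cancel r s⟩

theorem hilbertFunction_Ann_right
    (hq : homogeneousSubmodule σ k j = Submodule.span k (Set.range q))
    (hpq : ∀ v w, f.1 (p v * q w) = if v = w then 1 else 0) :
    hilbertFunction (Ann f) j = Fintype.card ι :=
  hilbertFunction_eq_card (p := q) (fun w ↦ hq ▸ Submodule.subset_span ⟨w, rfl⟩)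
    (hq ▸ le_sup_right) (φ := fun v ↦ f.1 ∘ₗ LinearMap.mulRight k (p v))
    (fun v r hr ↦ mem_Ann.1 hr _) fun v w ↦ by simp [mul_comm (q _), hpq]

end HilbertFunction

section ProductTable

variable {σ k : Type*} [DecidableEq σ] [Field k]

/-- The products of two variables in the apolar algebra of the cubic `f` are described by `t`: if
`t y z = some v` then `y * z` is the socle-dual of the variable `v`, and if `t y z = none` then
`y * z` vanishes. -/
structure HasProductTable (f : dividedPower σ k) (t : σ → σ → Option σ) : Prop where
  homogeneous : IsHomogeneousOfDegree f 3
  apply : ∀ x y z, f.1 (X x * (X y * X z)) = if t y z = some x then 1 else 0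
  surj : ∀ v, ∃ y z, t y z = some v

namespace HasProductTable

variable {f : dividedPower σ k} {t : σ → σ → Option σ}

theorem mem_Ann_of_quadric (hf : HasProductTable f t) {q : MvPolynomial σ k}
    (hq : q.IsHomogeneous 2) (h : ∀ x, f.1 (X x * q) = 0) : q ∈ Ann f :=
  mem_Ann_of_span hf.homogeneous rfl hq homogeneousSubmodule_one_eq_span_X fun x ↦ by
    rw [mul_comm, h]

theorem X_mul_X_mem_Ann (hf : HasProductTable f t) {y z : σ} (h : t y z = none) :
    X y * X z ∈ Ann f :=
  hf.mem_Ann_of_quadric (isHomogeneous_X_mul_X y z) fun x ↦ by simp [hf.apply, h]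

theorem X_mul_X_sub_mem_Ann (hf : HasProductTable f t) {y z y' z' : σ} (h : t y z = t y' z') :
    X y * X z - X y' * X z' ∈ Ann f :=
  hf.mem_Ann_of_quadric ((isHomogeneous_X_mul_X y z).sub (isHomogeneous_X_mul_X y' z'))
    fun x ↦ by simp [mul_sub, hf.apply, h]

theorem X_mul_X_mul_X_mem_Ann (hf : HasProductTable f t) {x y z : σ} (h : t y z ≠ some x) :
    X x * (X y * X z) ∈ Ann f :=
  mem_Ann_of_span (ι := Unit) (j := 0) (q := fun _ ↦ 1) hf.homogeneous rfl
    (isHomogeneous_X_mul_X_mul_X x y z) (by rw [homogeneousSubmodule_zero_eq_span, Set.range_const])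
    fun _ ↦ by simp [hf.apply, h]

theorem hilbertFunction_zero_three (hf : HasProductTable f t) [Nonempty σ] :
    hilbertFunction (Ann f) 0 = 1 ∧ hilbertFunction (Ann f) 3 = 1 := by
  obtain ⟨x⟩ := ‹Nonempty σ›
  obtain ⟨y, z, hyz⟩ := hf.surj x
  have hq : homogeneousSubmodule σ k 0 = Submodule.span k (Set.range fun _ : Unit ↦ 1) := by
    rw [homogeneousSubmodule_zero_eq_span, Set.range_const]
  have hpq (_ _ : Unit) : f.1 (X x * (X y * X z) * 1) = 1 := by simp [hf.apply, hyz]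
  exact ⟨hilbertFunction_Ann_right hq hpq, hilbertFunction_Ann_left hf.homogeneous rfl
    (fun _ ↦ isHomogeneous_X_mul_X_mul_X x y z) hq hpq⟩

theorem hilbertFunction_one_two [Fintype σ] (hf : HasProductTable f t) :
    hilbertFunction (Ann f) 1 = Fintype.card σ ∧ hilbertFunction (Ann f) 2 = Fintype.card σ := by
  choose y z hyz using hf.surj
  have hpq (v w : σ) : f.1 (X (y v) * X (z v) * X w) = if v = w then 1 else 0 := by
    rw [mul_comm, hf.apply, hyz]
    simp
  have hq := homogeneousSubmodule_one_eq_span_X (σ := σ) (R := k)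
  exact ⟨hilbertFunction_Ann_right hq hpq, hilbertFunction_Ann_left hf.homogeneous rfl
    (fun _ ↦ isHomogeneous_X_mul_X _ _) hq hpq⟩

theorem hilbertFunction_of_four_le (hf : HasProductTable f t) {i : ℕ} (hi : 4 ≤ i) :
    hilbertFunction (Ann f) i = 0 :=
  hilbertFunction_eq_zero fun _ hp ↦ mem_Ann_of_lt hf.homogeneous hi hp

end HasProductTable

end ProductTable

section ZMod

variable {m : ℕ}

theorem forall_iff_of_punctured_cycle [NeZero m] {P : ZMod m → Prop} {i j l : ZMod m}
    (step : ∀ l, l ≠ i → l + 1 ≠ i → (P l ↔ P (l + 1))) (hj : j ≠ i) (hl : l ≠ i) :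
    P j ↔ P l := by
  have ne {n : ℕ} (hn : n + 1 < m) : i + 1 + n ≠ i := by
    rw [Ne, add_assoc, add_eq_left]
    norm_cast
    rw [ZMod.natCast_eq_zero_iff]
    exact fun h ↦ by have := Nat.le_of_dvd (by lia) h; lia
  have reach_of_lt (n : ℕ) (hn : n + 1 < m) : P (i + 1 + n) ↔ P (i + 1) := by
    induction n with
    | zero => rw [Nat.cast_zero, add_zero]
    | succ n ih =>
      refine Iff.trans ?_ (ih (by lia))
      rw [Nat.cast_succ, ← add_assoc]
      exact (step _ (ne (by lia)) (by simpa [add_assoc] using ne hn)).symm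
  have reach {l : ZMod m} (hl : l ≠ i) : P l ↔ P (i + 1) := by
    have hval : (l - (i + 1)).val + 1 < m := by
      refine lt_of_le_of_ne (ZMod.val_lt _) fun h ↦ hl ?_
      have := congrArg (Nat.cast (R := ZMod m)) h
      simp only [Nat.cast_add, ZMod.natCast_zmod_val, Nat.cast_one, CharP.cast_eq_zero] at this
      linear_combination this
    simpa using reach_of_lt _ hval
  exact (reach hj).trans (reach hl).symm

variable [Fact (6 ≤ m)]

/- The multiples of `1` are spelled out because `grind` normalizes numerals in `ZMod m` and then
loses these facts; for the same reason `1` is generalized before most calls of `grind` below. -/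
theorem multiples_one_ne_zero :
    (1 : ZMod m) ≠ 0 ∧ (1 + 1 : ZMod m) ≠ 0 ∧ (1 + 1 + 1 : ZMod m) ≠ 0 ∧
      (1 + 1 + 1 + 1 : ZMod m) ≠ 0 ∧ (1 + 1 + 1 + 1 + 1 : ZMod m) ≠ 0 := by
  have natCast_ne_zero (n : ℕ) (hn : n ≠ 0) (hn' : n < 6) : (n : ZMod m) ≠ 0 := by
    rw [Ne, ZMod.natCast_eq_zero_iff]
    exact fun h ↦ by have := Nat.le_of_dvd (by lia) h; have hm : 6 ≤ m := Fact.out; lia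
  refine ⟨?_, ?_, ?_, ?_, ?_⟩
  · simpa using natCast_ne_zero 1
  · simpa [one_add_one_eq_two] using natCast_ne_zero 2
  · convert natCast_ne_zero 3 (by simp) (by simp); norm_num
  · convert natCast_ne_zero 4 (by simp) (by simp); norm_num
  · convert natCast_ne_zero 5 (by simp) (by simp); norm_num

theorem exists_ne_of_five (i₁ i₂ i₃ i₄ i₅ : ZMod m) :
    ∃ j, j ≠ i₁ ∧ j ≠ i₂ ∧ j ≠ i₃ ∧ j ≠ i₄ ∧ j ≠ i₅ := by
  have hm : 6 ≤ m := Fact.out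
  have : NeZero m := ⟨by lia⟩
  have hcard : Finset.card {i₁, i₂, i₃, i₄, i₅} < (Finset.univ : Finset (ZMod m)).card := by
    rw [Finset.card_univ, ZMod.card]
    exact Finset.card_le_five.trans_lt (by lia)
  obtain ⟨j, -, hj⟩ := Finset.exists_mem_notMem_of_card_lt_card hcard
  exact ⟨j, by simpa using hj⟩

end ZMod

local notation:max "𝐚" i:max => Sum.inl ((0 : Fin 3), i)
local notation:max "𝐛" i:max => Sum.inl ((1 : Fin 3), i)
local notation:max "𝐜" i:max => Sum.inl ((2 : Fin 3), i)
local notation "𝐝" => Sum.inr ()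

variable {m : ℕ}

section Third

/-- The variable `v` such that `v * x * y` is a monomial of the cubic `F'`, if there is one. Two
distinct letters `s`, `t` determine the remaining one as `-(s + t)` in `Fin 3`. -/
def third : Var m → Var m → Option (Var m)
  | .inl (s, i), .inl (t, j) =>
    if s = t then
      if j = i then some (.inl (s, i - 1))
      else if j = i + 1 then some (.inl (s, j))
      else if i = j + 1 then some (.inl (s, i))
      else none
    else if j = i then some (.inl (-(s + t), i))
    else if s = 0 ∧ t = 1 ∧ j = i + 1 then some 𝐝
    else if s = 1 ∧ t = 0 ∧ i = j + 1 then some 𝐝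
    else none
  | .inl (s, i), .inr _ | .inr _, .inl (s, i) =>
    if s = 0 then some (𝐛 (i + 1)) else if s = 1 then some (𝐚 (i - 1)) else none
  | .inr _, .inr _ => none

theorem third_self (t : Fin 3) (i : ZMod m) :
    third (.inl (t, i + 1)) (.inl (t, i + 1)) = some (.inl (t, i)) := by
  simp [third]

theorem third_same_index {r s t : Fin 3} (hrs : r ≠ s) (hst : s ≠ t) (htr : t ≠ r) (i : ZMod m) :
    third (.inl (s, i)) (.inl (t, i)) = some (.inl (r, i)) := by
  simp only [third, if_neg hst, if_true]
  congr
  grind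

theorem third_b_c (i : ZMod m) : third (𝐛 i) (𝐜 i) = some (𝐚 i) :=
  third_same_index (by simp) (by simp) (by simp) i

theorem third_a_c (i : ZMod m) : third (𝐚 i) (𝐜 i) = some (𝐛 i) :=
  third_same_index (by simp) (by simp) (by simp) i

theorem third_a_b (i : ZMod m) : third (𝐚 i) (𝐛 i) = some (𝐜 i) :=
  third_same_index (by simp) (by simp) (by simp) i

theorem third_a_d (i : ZMod m) : third (𝐚 i) 𝐝 = some (𝐛 (i + 1)) := rfl

theorem third_d_a (i : ZMod m) : third 𝐝 (𝐚 i) = some (𝐛 (i + 1)) := rfl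

theorem third_b_succ_d (i : ZMod m) : third (𝐛 (i + 1)) 𝐝 = some (𝐚 i) := by
  simp [third]

theorem third_d_b_succ (i : ZMod m) : third 𝐝 (𝐛 (i + 1)) = some (𝐚 i) := by
  simp [third]

theorem third_d_d : third (m := m) 𝐝 𝐝 = none := rfl

theorem third_same_letter_eq_none_iff {t : Fin 3} {i j : ZMod m} :
    third (.inl (t, i)) (.inl (t, j)) = none ↔ j ≠ i ∧ j ≠ i + 1 ∧ i ≠ j + 1 := by
  grind [third]

theorem third_a_b_eq_none_iff {i j : ZMod m} :
    third (𝐚 i) (𝐛 j) = none ↔ j ≠ i ∧ j ≠ i + 1 := by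
  grind [third]

theorem third_b_a_eq_none_iff {i j : ZMod m} :
    third (𝐛 i) (𝐚 j) = none ↔ i ≠ j ∧ i ≠ j + 1 := by
  grind [third]

theorem third_c_left_eq_none_iff {t : Fin 3} (ht : t ≠ 2) {i j : ZMod m} :
    third (𝐜 i) (.inl (t, j)) = none ↔ j ≠ i := by
  grind [third]

theorem third_c_right_eq_none_iff {t : Fin 3} (ht : t ≠ 2) {i j : ZMod m} :
    third (.inl (t, i)) (𝐜 j) = none ↔ j ≠ i := by
  grind [third]

theorem third_d_left_eq_none_iff {t : Fin 3} {i : ZMod m} :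
    third 𝐝 (.inl (t, i)) = none ↔ t = 2 := by
  grind [third]

theorem third_d_right_eq_none_iff {t : Fin 3} {i : ZMod m} :
    third (.inl (t, i)) 𝐝 = none ↔ t = 2 := by
  grind [third]

theorem third_same_index_ne_none {s t : Fin 3} {i : ZMod m} :
    third (.inl (s, i)) (.inl (t, i)) ≠ none := by
  grind [third]

theorem eq_or_eq_of_third_eq_d {w x : Var m} (h : third w x = some 𝐝) :
    ∃ i, w = 𝐚 i ∧ x = 𝐛 (i + 1) ∨ w = 𝐛 (i + 1) ∧ x = 𝐚 i := by
  grind [third]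

theorem exists_third_c_eq (t : Fin 3) (l : ZMod m) :
    ∃ y, third (𝐜 (if t = 2 then l + 1 else l)) y = some (.inl (t, l)) := by
  fin_cases t
  · exact ⟨𝐛 l, third_same_index (by simp) (by simp) (by simp) l⟩
  · exact ⟨𝐚 l, third_same_index (by simp) (by simp) (by simp) l⟩
  · exact ⟨𝐜 (l + 1), third_self 2 l⟩

variable [Fact (6 ≤ m)]

theorem third_comm (x y : Var m) : third x y = third y x := by
  have ne_zero := multiples_one_ne_zero (m := m)
  rcases x with ⟨s, i⟩ | ⟨⟩ <;> rcases y with ⟨t, j⟩ | ⟨⟩ <;> try rfl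
  simp only [third, add_comm t s]
  generalize (1 : ZMod m) = e at *
  grind

theorem third_rotate {x y z : Var m} (h : third y z = some x) : third x z = some y := by
  have ne_zero := multiples_one_ne_zero (m := m)
  rcases x with ⟨r, l⟩ | ⟨⟩ <;> rcases y with ⟨s, i⟩ | ⟨⟩ <;> rcases z with ⟨t, j⟩ | ⟨⟩ <;>
    simp only [third] at h ⊢ <;>
    generalize (1 : ZMod m) = e at * <;>
    grind

theorem third_succ (t : Fin 3) (i : ZMod m) :
    third (.inl (t, i)) (.inl (t, i + 1)) = some (.inl (t, i + 1)) := by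
  simp [third, multiples_one_ne_zero.1]

theorem third_a_b_succ (i : ZMod m) : third (𝐚 i) (𝐛 (i + 1)) = some 𝐝 := by
  simp [third, multiples_one_ne_zero.1]

theorem third_b_succ_a (i : ZMod m) : third (𝐛 (i + 1)) (𝐚 i) = some 𝐝 := by
  rw [third_comm, third_a_b_succ]

theorem exists_third_a_eq_none (y : Fin 3 × ZMod m) : ∃ i, third (𝐚 i) (.inl y) = none := by
  obtain ⟨i, hi⟩ := exists_ne_of_five y.2 (y.2 - 1) (y.2 + 1) 0 0
  use i
  have ne_zero := multiples_one_ne_zero (m := m)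
  simp only [third]
  generalize (1 : ZMod m) = e at *
  grind

end Third

section Lines

/-- The variables, with multiplicity, of the monomials of `F'`: at `(.inl s, i)` those of `s`-th
letter and indices `i, i + 1, i + 1`, and at `(.inr 0, i)`, `(.inr 1, i)` the monomials
`aᵢ bᵢ cᵢ`, `aᵢ bᵢ₊₁ d`. -/
def line : (Fin 3 ⊕ Fin 2) × ZMod m → Multiset (Var m)
  | (.inl s, i) => {.inl (s, i), .inl (s, i + 1), .inl (s, i + 1)}
  | (.inr 0, i) => {𝐚 i, 𝐛 i, 𝐜 i}
  | (.inr 1, i) => {𝐚 i, 𝐛 (i + 1), 𝐝}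

theorem cubicF'_eq_sum (k : Type*) [Field k] [NeZero m] :
    cubicF' k m = ∑ l : (Fin 3 ⊕ Fin 2) × ZMod m, monomial (Multiset.toFinsupp (line l)) 1 := by
  simp only [Fintype.sum_prod_type, Fintype.sum_sum_type, Fin.sum_univ_three, Fin.sum_univ_two,
    line, ← X_mul_X_mul_X_eq_monomial, ← Finset.sum_add_distrib, cubicF', cubicF, a, b, c, d]
  exact Finset.sum_congr rfl fun i _ ↦ by ring

theorem isHomogeneous_cubicF' (k : Type*) [Field k] [NeZero m] :
    (cubicF' k m).IsHomogeneous 3 := by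
  rw [cubicF'_eq_sum]
  refine .sum _ _ _ fun l _ ↦ ?_
  obtain ⟨x, y, z, hl⟩ : ∃ x y z, line l = {x, y, z} := by
    obtain ⟨s | s, i⟩ := l
    · exact ⟨_, _, _, rfl⟩
    · fin_cases s <;> exact ⟨_, _, _, rfl⟩
  rw [hl, ← X_mul_X_mul_X_eq_monomial]
  exact isHomogeneous_X_mul_X_mul_X x y z

theorem exists_line_eq {x y z : Var m} (h : third y z = some x) : ∃ l, line l = {x, y, z} := by
  have swap {x y z : Var m} : (∃ l, line l = {x, y, z}) ↔ ∃ l, line l = {y, x, z} := by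
    simp only [Multiset.insert_eq_cons, Multiset.cons_swap]
  have swap' {x y z : Var m} : (∃ l, line l = {x, y, z}) ↔ ∃ l, line l = {x, z, y} := by
    rw [Multiset.pair_comm]
  obtain ⟨s, i⟩ | ⟨⟩ := y <;> obtain ⟨t, j⟩ | ⟨⟩ := z <;> simp only [third] at h
  · split_ifs at h with hst hij hij hij hij hij hij <;> cases h
    · subst hst hij
      exact ⟨(.inl s, j - 1), by simp [line]⟩
    · subst hst hij
      exact swap.2 ⟨(.inl s, i), rfl⟩
    · subst hst hij
      exact swap'.2 (swap.2 ⟨(.inl s, j), rfl⟩)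
    · subst hij
      have letters : ∀ s t : Fin 3, s ≠ t → ({0, 1, 2} : Multiset (Fin 3)) = {-(s + t), s, t} := by
        decide
      exact ⟨(.inr 0, j),
        congrArg (Multiset.map fun r ↦ (Sum.inl (r, j) : Var m)) (letters s t hst)⟩
    · obtain ⟨rfl, rfl, rfl⟩ := hij
      exact swap.2 (swap'.2 ⟨(.inr 1, i), rfl⟩)
    · obtain ⟨rfl, rfl, rfl⟩ := hij
      exact swap'.2 (swap.2 (swap'.2 ⟨(.inr 1, j), rfl⟩))
  · split_ifs at h with hs hs <;> cases h <;> subst hs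
    · exact swap.2 ⟨(.inr 1, i), rfl⟩
    · exact ⟨(.inr 1, i - 1), by simp [line]⟩
  · split_ifs at h with hs hs <;> cases h <;> subst hs
    · exact swap'.2 (swap.2 ⟨(.inr 1, j), rfl⟩)
    · exact swap'.2 ⟨(.inr 1, j - 1), by simp [line]⟩
  · cases h

theorem rel_of_multiset_eq {α : Type*} {R : α → α → α → Prop}
    (swap_left : ∀ {x y z}, R x y z → R y x z) (swap_right : ∀ {x y z}, R x y z → R x z y)
    {x y z x' y' z' : α} (h : ({x, y, z} : Multiset α) = {x', y', z'}) (hR : R x y z) :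
    R x' y' z' := by
  classical
  have count (w : α) := congrArg (Multiset.count w) h
  simp only [Multiset.insert_eq_cons, Multiset.count_cons, Multiset.count_singleton] at count
  have hx := count x
  have hy := count y
  have hz := count z
  clear h count
  grind

variable [Fact (6 ≤ m)]

theorem third_of_line_eq {x y z : Var m} {l : (Fin 3 ⊕ Fin 2) × ZMod m}
    (h : line l = {x, y, z}) : third y z = some x := by
  have of_eq {x' y' z' : Var m} (hl : line l = {x', y', z'}) (h' : third y' z' = some x') :
      third y z = some x :=
    rel_of_multiset_eq (R := fun x y z ↦ third y z = some x) third_rotate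
      (fun h ↦ (third_comm _ _).trans h) (hl.symm.trans h) h'
  obtain ⟨s | s, i⟩ := l
  · exact of_eq rfl (third_self s i)
  · fin_cases s
    · exact of_eq rfl (third_b_c i)
    · exact of_eq rfl (third_b_succ_d i)

theorem line_injective : Function.Injective (line (m := m)) := by
  intro l l' h
  have ne_zero := multiples_one_ne_zero (m := m)
  have mem_iff (u) : u ∈ line l ↔ u ∈ line l' := by rw [h]
  rcases l with ⟨s | s, i⟩ <;> rcases l' with ⟨t | t, j⟩
  · have := mem_iff (.inl (s, i))
    have := mem_iff (.inl (s, i + 1))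
    have := mem_iff (.inl (t, j))
    grind [line, Multiset.insert_eq_cons, Multiset.mem_singleton]
  · have := mem_iff (𝐚 j)
    have := mem_iff (𝐛 j)
    have := mem_iff (𝐛 (j + 1))
    fin_cases t <;> grind [line, Multiset.insert_eq_cons, Multiset.mem_singleton]
  · have := mem_iff (𝐚 i)
    have := mem_iff (𝐛 i)
    have := mem_iff (𝐛 (i + 1))
    fin_cases s <;> grind [line, Multiset.insert_eq_cons, Multiset.mem_singleton]
  · have := mem_iff (𝐚 i)
    have := mem_iff 𝐝
    fin_cases t <;> fin_cases s <;> grind [line, Multiset.insert_eq_cons, Multiset.mem_singleton]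

theorem hasProductTable_cubicF' (k : Type*) [Field k] [NeZero m] :
    HasProductTable (dualElement (cubicF' k m)) third where
  homogeneous := isHomogeneousOfDegree_dualElement (isHomogeneous_cubicF' k)
  apply x y z := by
    simp only [X_mul_X_mul_X_eq_monomial, dualElement_apply_monomial, cubicF'_eq_sum, coeff_sum,
      coeff_monomial, Multiset.toFinsupp.injective.eq_iff]
    split_ifs with h
    · obtain ⟨l, hl⟩ := exists_line_eq h
      simp only [← hl, line_injective.eq_iff, Finset.sum_ite_eq', Finset.mem_univ, if_true]
    · exact Finset.sum_eq_zero fun l _ ↦ if_neg fun hl ↦ h (third_of_line_eq hl)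
  surj
    | .inl (s, i) => ⟨_, _, third_self s i⟩
    | .inr () => ⟨_, _, third_a_b_succ 0⟩

end Lines

section Quartics

/-- Closure properties of the set of quadruples of variables whose product lies in a given subspace
containing `Ann(F')²`. By `base`, for each variable `w` the product of `w` with one monomial
`aⱼ bⱼ cⱼ` of index different from that of `w` is among them. -/
structure QuarticRelations (Z : Var m → Var m → Var m → Var m → Prop) : Prop where
  swap_left : ∀ {w x y z}, Z w x y z → Z x w y z
  swap_mid : ∀ {w x y z}, Z w x y z → Z w y x z
  swap_right : ∀ {w x y z}, Z w x y z → Z w x z y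
  of_eq_none : ∀ {w x y z}, third w x = none → third y z = none → Z w x y z
  congr : ∀ {w x y z y' z'}, third w x = none → third y z = third y' z' → Z w x y' z' →
    Z w x y z
  exchange : ∀ {w x y z w' x' y' z'}, third w x = third w' x' → third y z = third y' z' →
    Z w' x' y z → Z w x y' z' → Z w' x' y' z' → Z w x y z
  base : ∀ w, ∃ j, (∀ t, w ≠ .inl (t, j)) ∧ Z w (𝐚 j) (𝐛 j) (𝐜 j)

/-- All factorizations `y * z` of the class of products determined by `u`, that is
`third y z = some u`, satisfy `Z w x y z`: modulo `Z`, the product `w * x` annihilates that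
class. -/
def Kills (Z : Var m → Var m → Var m → Var m → Prop) (w x u : Var m) : Prop :=
  ∀ ⦃y z⦄, third y z = some u → Z w x y z

namespace QuarticRelations

variable {Z : Var m → Var m → Var m → Var m → Prop}

theorem swap_pairs (H : QuarticRelations Z) {w x y z : Var m} (h : Z w x y z) : Z y z w x :=
  H.swap_mid (H.swap_left (H.swap_right (H.swap_mid h)))

theorem kills_of_mem (H : QuarticRelations Z) {w x y z u : Var m} (hwx : third w x = none)
    (hyz : third y z = some u) (h : Z w x y z) : Kills Z w x u :=
  fun _ _ hu ↦ H.congr hwx (hu.trans hyz.symm) h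

theorem kills_swap (H : QuarticRelations Z) {w x u : Var m} (h : Kills Z w x u) : Kills Z x w u :=
  fun _ _ hu ↦ H.swap_left (h hu)

theorem kills_of_kills (H : QuarticRelations Z) {w x u v y z : Var m} (hwx : third w x = none)
    (hyz : third y z = some u) (hxz : third x z = some v) (h : Kills Z w y v) : Kills Z w x u :=
  H.kills_of_mem hwx hyz (H.swap_mid (h hxz))

end QuarticRelations

end Quartics

section RepeatedVariable

namespace QuarticRelations

variable {Z : Var m → Var m → Var m → Var m → Prop}

theorem kills_self_of_kills_self (H : QuarticRelations Z) {w x y z : Var m}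
    (hwy : third w y = none) (hyz : third y z = some x) (hxz : third x z = some y)
    (h : Kills Z w x x) : Kills Z w y y :=
  H.kills_of_mem hwy hxz (H.swap_mid (h hyz))

theorem kills_self_same_index (H : QuarticRelations Z) {w : Var m} {s t : Fin 3} {i : ZMod m}
    (hw : third w (.inl (t, i)) = none) (h : Kills Z w (.inl (s, i)) (.inl (s, i))) :
    Kills Z w (.inl (t, i)) (.inl (t, i)) := by
  obtain rfl | hst := eq_or_ne s t
  · exact h
  · obtain ⟨r, hrs, hrt⟩ : ∃ r, r ≠ s ∧ r ≠ t := by clear hw h; decide +revert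
    exact H.kills_self_of_kills_self hw (third_same_index hst hrt.symm hrs i)
      (third_same_index hst.symm hrs.symm hrt i) h

theorem kills_c_of_base (H : QuarticRelations Z) {w : Var m} {j : ZMod m}
    (hw : third w (𝐜 j) = none) (hj : Z w (𝐚 j) (𝐛 j) (𝐜 j)) : Kills Z w (𝐜 j) (𝐜 j) :=
  H.kills_of_mem hw (third_a_b j) (H.swap_mid (H.swap_right hj))

variable [Fact (6 ≤ m)]

theorem kills_self_c_of_kills_self_c (H : QuarticRelations Z) {w : Var m} {i j l : ZMod m}
    (hw : ∀ l, l ≠ i → third w (𝐜 l) = none) (hj : j ≠ i) (hl : l ≠ i)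
    (h : Kills Z w (𝐜 j) (𝐜 j)) : Kills Z w (𝐜 l) (𝐜 l) :=
  have : NeZero m := ⟨by have hm : 6 ≤ m := Fact.out; lia⟩
  (forall_iff_of_punctured_cycle (P := fun l ↦ Kills Z w (𝐜 l) (𝐜 l)) (fun l hl hl' ↦
    ⟨H.kills_self_of_kills_self (hw _ hl') (third_self 2 l) (third_succ 2 l),
      H.kills_self_of_kills_self (hw _ hl) (third_succ 2 l) (third_self 2 l)⟩) hj hl).1 h

theorem kills_self_a_b (H : QuarticRelations Z) {t : Fin 3} (ht : t ≠ 2) {i : ZMod m} {x : Var m}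
    (hx : third (.inl (t, i)) x = none) : Kills Z (.inl (t, i)) x x := by
  obtain ⟨j, hij, hj⟩ := H.base (.inl (t, i))
  have hc (l) (hl : l ≠ i) : third (.inl (t, i)) (𝐜 l) = none :=
    (third_c_right_eq_none_iff ht).2 hl
  have hji : j ≠ i := by rintro rfl; exact hij t rfl
  rcases x with ⟨s, l⟩ | ⟨⟩
  · have hl : l ≠ i := by rintro rfl; exact third_same_index_ne_none hx
    exact H.kills_self_same_index hx
      (H.kills_self_c_of_kills_self_c hc hji hl (H.kills_c_of_base (hc j hji) hj))
  · exact absurd (third_d_right_eq_none_iff.1 hx) ht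

theorem kills_self_c (H : QuarticRelations Z) {i : ZMod m} {x : Var m}
    (hx : third (𝐜 i) x = none) : Kills Z (𝐜 i) x x := by
  obtain ⟨j, hij, hj⟩ := H.base (𝐜 i)
  have ha (l) (hl : l ≠ i) : third (𝐜 i) (𝐚 l) = none :=
    (third_c_left_eq_none_iff (by simp)).2 hl
  have hji : j ≠ i := by rintro rfl; exact hij 2 rfl
  have hd : Kills Z (𝐜 i) 𝐝 𝐝 :=
    H.kills_self_of_kills_self (third_d_right_eq_none_iff.2 rfl) (third_d_b_succ j)
      (third_a_b_succ j) (H.kills_of_mem (ha j hji) (third_b_c j) hj)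
  rcases x with ⟨s, l⟩ | ⟨⟩
  · have hl : l ≠ i := by rintro rfl; exact third_same_index_ne_none hx
    exact H.kills_self_same_index hx (s := 0) <|
      H.kills_self_of_kills_self (ha l hl) (third_a_b_succ l) (third_d_b_succ l) hd
  · exact hd

theorem kills_d_c_c (H : QuarticRelations Z) (l : ZMod m) : Kills Z 𝐝 (𝐜 l) (𝐜 l) := by
  obtain ⟨j, -, hj⟩ := H.base 𝐝
  obtain ⟨i, hij, hil, -⟩ := exists_ne_of_five j l l l l
  have hd (l : ZMod m) : third 𝐝 (𝐜 l) = none := third_d_left_eq_none_iff.2 rfl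
  exact H.kills_self_c_of_kills_self_c (fun l _ ↦ hd l) hij.symm hil.symm
    (H.kills_c_of_base (hd j) hj)

theorem kills_d_d_d (H : QuarticRelations Z) : Kills Z 𝐝 𝐝 𝐝 := by
  have orth : Z (𝐚 (0 + 1)) (𝐜 (0 + 1)) (𝐛 0) (𝐜 0) := by
    have h : (0 : ZMod m) ≠ 0 + 1 := by simpa using multiples_one_ne_zero.1.symm
    exact H.swap_right (H.swap_mid (H.of_eq_none ((third_c_right_eq_none_iff (by simp)).2 h)
      ((third_c_left_eq_none_iff (by simp)).2 h)))
  -- `d * a₀` and `a₁ * c₁` determine the same variable, as do `d * b₁` and `b₀ * c₀`.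
  have exchanged : Z 𝐝 (𝐚 0) 𝐝 (𝐛 (0 + 1)) :=
    H.exchange ((third_d_a 0).trans (third_a_c (0 + 1)).symm)
      ((third_d_b_succ 0).trans (third_b_c 0).symm)
      (H.swap_mid (H.swap_left (H.swap_mid (H.kills_d_c_c (0 + 1) (third_a_b (0 + 1))))))
      (H.swap_right (H.swap_mid (H.kills_d_c_c 0 (third_a_b 0)))) orth
  exact H.kills_of_mem third_d_d (third_a_b_succ 0) (H.swap_mid exchanged)

theorem kills_self_d (H : QuarticRelations Z) {x : Var m} (hx : third 𝐝 x = none) :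
    Kills Z 𝐝 x x := by
  rcases x with ⟨s, l⟩ | ⟨⟩
  · obtain rfl := third_d_left_eq_none_iff.1 hx
    exact H.kills_d_c_c l
  · exact H.kills_d_d_d

theorem kills_self (H : QuarticRelations Z) {w x : Var m} (hwx : third w x = none) :
    Kills Z w x x := by
  rcases w with ⟨t, i⟩ | ⟨⟨⟩⟩
  · obtain ht | rfl := ne_or_eq t 2
    · exact H.kills_self_a_b ht hwx
    · exact H.kills_self_c hwx
  · exact H.kills_self_d hwx

end QuarticRelations

end RepeatedVariable

section Separation

/-- Some factorization `y * z` of the class determined by `u` is such that `w * y` and `x * z`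
vanish; then `w * x * y * z` is a product of two elements of the apolar ideal. -/
def Separates (u w x : Var m) : Prop :=
  ∃ y z, third y z = some u ∧ third w y = none ∧ third x z = none

/-- For some factorization `y * z` of the class determined by `u`, the product `w * y` vanishes and
the class of `x * z`, determined by `v`, separates `w` and `y`. Exchanging `x` and `y` then reduces
`w * x * y * z` to a case of `Separates`. -/
def SeparatesInTwoSteps (u w x : Var m) : Prop :=
  ∃ y z v, third y z = some u ∧ third x z = some v ∧ third w y = none ∧ Separates v w y

/-- The triples, up to exchanging the last two entries, for which no single factorization is
enough: if `w * x` vanishes and `u` differs from `w` and `x`, then `Separates u w x` can fail only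
on this list. -/
def Exceptional : Var m → Var m → Var m → Prop
  | 𝐚 _, 𝐝, 𝐝 => True
  | 𝐛 _, 𝐝, 𝐝 => True
  | 𝐚 l, 𝐚 i, 𝐛 j => l = i + 1 ∧ j = l + 1
  | 𝐚 l, 𝐛 i, 𝐚 j => i = l ∧ (j = l + 1 ∨ j = l + 1 + 1)
  | 𝐚 l, 𝐛 i, 𝐛 j => i = l ∧ j = l + 1 + 1
  | 𝐚 l, 𝐛 i, 𝐜 j => i = l ∧ j = l + 1
  | 𝐚 l, 𝐜 i, 𝐚 j => i = l ∧ j = l + 1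
  | 𝐚 l, 𝐜 i, 𝐛 j => i = l ∧ j = l + 1
  | 𝐛 l, 𝐚 i, 𝐚 j => l = i + 1 ∧ j = l + 1
  | 𝐛 l, 𝐚 i, 𝐛 j => l = i + 1 ∧ j = l + 1 ∨ i = l ∧ l = j + 1
  | 𝐜 l, 𝐚 i, 𝐜 j => i = l ∧ j = l + 1
  | 𝐜 l, 𝐛 i, 𝐜 j => i = l ∧ j = l + 1 ∨ i = l + 1 ∧ l = j + 1
  | _, _, _ => False

section

variable [Fact (6 ≤ m)]

theorem separates_d (w x : Fin 3 × ZMod m) : Separates 𝐝 (.inl w) (.inl x) := by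
  have ne_zero := multiples_one_ne_zero (m := m)
  obtain ⟨s, i⟩ := w
  obtain ⟨t, l⟩ := x
  obtain rfl | hs := eq_or_ne s 0
  · obtain ⟨j, hj⟩ := exists_ne_of_five i (i - 1) l (l + 1) (l - 1)
    refine ⟨𝐛 (j + 1), 𝐚 j, third_b_succ_a j, ?_⟩
    simp only [third]
    generalize (1 : ZMod m) = e at *
    grind
  · obtain ⟨j, hj⟩ := exists_ne_of_five i (i - 1) l (l - 1) (l - 1 - 1)
    refine ⟨𝐚 j, 𝐛 (j + 1), third_a_b_succ j, ?_⟩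
    simp only [third]
    generalize (1 : ZMod m) = e at *
    grind

theorem separatesInTwoSteps_of_exceptional : ∀ u w x : Var m, Exceptional u w x →
    SeparatesInTwoSteps u w x ∨ SeparatesInTwoSteps u x w := by
  have ne_zero := multiples_one_ne_zero (m := m)
  refine fun
    | 𝐚 l, 𝐝, 𝐝, _ => .inl ⟨𝐜 l, 𝐛 l, 𝐚 (l - 1), ?_, ?_, ?_, 𝐜 (l - 1), 𝐛 (l - 1), ?_⟩
    | 𝐛 l, 𝐝, 𝐝, _ => .inl ⟨𝐜 l, 𝐚 l, 𝐛 (l + 1), ?_, ?_, ?_, 𝐜 (l + 1), 𝐚 (l + 1), ?_⟩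
    | 𝐚 l, 𝐚 i, 𝐛 j, h => .inl ⟨𝐜 l, 𝐛 l, 𝐛 (l + 1), ?_, ?_, ?_, 𝐜 (l + 1), 𝐚 (l + 1), ?_⟩
    | 𝐚 l, 𝐛 i, 𝐚 j, h => .inr ⟨𝐚 (l - 1), 𝐚 l, 𝐜 l, ?_, ?_, ?_, 𝐜 (l - 1), 𝐜 l, ?_⟩
    | 𝐚 l, 𝐛 i, 𝐛 j, h => .inr ⟨𝐚 (l - 1), 𝐚 l, 𝐜 l, ?_, ?_, ?_, 𝐜 (l - 1), 𝐜 l, ?_⟩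
    | 𝐚 l, 𝐛 i, 𝐜 j, h => .inr ⟨𝐚 (l - 1), 𝐚 l, 𝐜 l, ?_, ?_, ?_, 𝐜 (l - 1), 𝐜 l, ?_⟩
    | 𝐚 l, 𝐜 i, 𝐚 j, h => .inl ⟨𝐚 (l - 1), 𝐚 l, 𝐚 (l + 1), ?_, ?_, ?_, 𝐛 (l + 1), 𝐜 (l + 1), ?_⟩
    | 𝐚 l, 𝐜 i, 𝐛 j, h => .inl ⟨𝐚 (l - 1), 𝐚 l, 𝐝, ?_, ?_, ?_, 𝐚 (l + 1), 𝐛 (l + 1 + 1), ?_⟩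
    | 𝐛 l, 𝐚 i, 𝐚 j, h => .inl ⟨𝐜 l, 𝐚 l, 𝐚 (l + 1), ?_, ?_, ?_, 𝐜 (l + 1), 𝐛 (l + 1), ?_⟩
    | 𝐛 l, 𝐚 i, 𝐛 j, .inl h => .inl ⟨𝐜 l, 𝐚 l, 𝐝, ?_, ?_, ?_, 𝐚 (l + 1), 𝐛 (l + 1 + 1), ?_⟩
    | 𝐛 l, 𝐚 i, 𝐛 j, .inr h =>
      .inr ⟨𝐛 (l + 1), 𝐛 (l + 1), 𝐝, ?_, ?_, ?_, 𝐚 (l + 1 + 1), 𝐛 (l + 1 + 1 + 1), ?_⟩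
    | 𝐜 l, 𝐚 i, 𝐜 j, h =>
      .inl ⟨𝐜 (l - 1), 𝐜 l, 𝐜 (l + 1), ?_, ?_, ?_, 𝐜 (l + 1 + 1), 𝐜 (l + 1 + 1), ?_⟩
    | 𝐜 l, 𝐛 i, 𝐜 j, .inl h =>
      .inl ⟨𝐜 (l - 1), 𝐜 l, 𝐜 (l + 1), ?_, ?_, ?_, 𝐜 (l + 1 + 1), 𝐜 (l + 1 + 1), ?_⟩
    | 𝐜 l, 𝐛 i, 𝐜 j, .inr h => .inr ⟨𝐚 l, 𝐛 l, 𝐛 (l + 1), ?_, ?_, ?_, 𝐚 (l + 1), 𝐜 (l + 1), ?_⟩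
  all_goals
    simp only [third, Exceptional] at *
    generalize (1 : ZMod m) = e at *
    simp <;> grind

set_option maxHeartbeats 400000 in
-- The proof checks the `48` combinations of letters separately.
theorem separates_or_exceptional {w x : Var m} {t : Fin 3} {l : ZMod m} (hwx : third w x = none)
    (hw : .inl (t, l) ≠ w) (hx : .inl (t, l) ≠ x) :
    Separates (.inl (t, l)) w x ∨ Exceptional (.inl (t, l)) w x ∨
      Exceptional (.inl (t, l)) x w := by
  by_contra! ⟨not_separates, not_exceptional, not_exceptional'⟩
  have ne_none (y z) (h : third y z = some (.inl (t, l))) : third w y = none → third x z ≠ none :=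
    fun hy hz ↦ not_separates ⟨y, z, h, hy, hz⟩
  obtain ⟨i, rfl⟩ : ∃ i, l = i + 1 := ⟨l - 1, (sub_add_cancel l 1).symm⟩
  -- The factorizations of the class determined by a variable of index `i + 1`.
  have self := ne_none _ _ (third_self t (i + 1))
  have succ := ne_none _ _ (third_succ t i)
  have succ' := ne_none _ _ ((third_comm _ _).trans (third_succ t i))
  have same_index (r s) (hr : t ≠ r) (hs : r ≠ s) (hs' : s ≠ t) :=
    ne_none _ _ (third_same_index hr hs hs' (i + 1))
  have d_b (ht : 0 = t) := ne_none 𝐝 (𝐛 (i + 1 + 1)) (ht ▸ third_d_b_succ (i + 1))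
  have b_d (ht : 0 = t) := ne_none (𝐛 (i + 1 + 1)) 𝐝 (ht ▸ third_b_succ_d (i + 1))
  have a_d (ht : 1 = t) := ne_none (𝐚 i) 𝐝 (ht ▸ third_a_d i)
  have d_a (ht : 1 = t) := ne_none 𝐝 (𝐚 i) (ht ▸ third_d_a i)
  have ne_zero := multiples_one_ne_zero (m := m)
  clear not_separates ne_none
  rcases w with ⟨r, i₁⟩ | ⟨⟨⟩⟩ <;> rcases x with ⟨s, i₂⟩ | ⟨⟨⟩⟩ <;> fin_cases t
  all_goals try fin_cases r
  all_goals try fin_cases s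
  all_goals
    simp only [third_same_letter_eq_none_iff, third_a_b_eq_none_iff, third_b_a_eq_none_iff,
      third_c_left_eq_none_iff, third_c_right_eq_none_iff, third_d_left_eq_none_iff,
      third_d_right_eq_none_iff, third_d_d, Exceptional, Fin.forall_fin_succ, Fin.zero_eta,
      Fin.mk_one, Fin.reduceFinMk, Fin.succ_zero_eq_one, Fin.succ_one_eq_two, Fin.isValue,
      Fin.reduceEq, zero_ne_one, one_ne_zero, Sum.inl.injEq, Prod.mk.injEq, reduceCtorEq, ne_eq,
      not_true, not_false_iff, true_imp_iff, IsEmpty.forall_iff, true_and, false_and, and_true,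
      not_and] at *
  all_goals
    generalize (1 : ZMod m) = e at *
    grind +splitImp

end

namespace QuarticRelations

variable {Z : Var m → Var m → Var m → Var m → Prop}

theorem kills_of_separates (H : QuarticRelations Z) {w x u : Var m} (hwx : third w x = none) :
    Separates u w x → Kills Z w x u :=
  fun ⟨_, _, hyz, hwy, hxz⟩ ↦ H.kills_of_mem hwx hyz (H.swap_mid (H.of_eq_none hwy hxz))

theorem kills_of_separatesInTwoSteps (H : QuarticRelations Z) {w x u : Var m}
    (hwx : third w x = none) : SeparatesInTwoSteps u w x → Kills Z w x u :=
  fun ⟨_, _, _, hyz, hxz, hwy, h⟩ ↦ H.kills_of_kills hwx hyz hxz (H.kills_of_separates hwy h)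

variable [Fact (6 ≤ m)]

theorem kills_of_exceptional (H : QuarticRelations Z) {w x u : Var m} (hwx : third w x = none)
    (h : Exceptional u w x) : Kills Z w x u := by
  obtain h | h := separatesInTwoSteps_of_exceptional _ _ _ h
  · exact H.kills_of_separatesInTwoSteps hwx h
  · exact H.kills_swap (H.kills_of_separatesInTwoSteps ((third_comm x w).trans hwx) h)

theorem kills_of_ne (H : QuarticRelations Z) {w x u : Var m} (hwx : third w x = none) (hw : u ≠ w)
    (hx : u ≠ x) : Kills Z w x u := by
  rcases u with ⟨t, l⟩ | ⟨⟨⟩⟩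
  · obtain h | h | h := separates_or_exceptional hwx hw hx
    · exact H.kills_of_separates hwx h
    · exact H.kills_of_exceptional hwx h
    · exact H.kills_swap (H.kills_of_exceptional ((third_comm x w).trans hwx) h)
  · rcases w with w | ⟨⟨⟩⟩ <;> rcases x with x | ⟨⟨⟩⟩
    · exact H.kills_of_separates hwx (separates_d w x)
    all_goals contradiction

theorem of_third_eq_none (H : QuarticRelations Z) {w x : Var m} (hwx : third w x = none)
    (y z : Var m) : Z w x y z := by
  obtain hyz | ⟨u, hyz⟩ := (third y z).eq_none_or_eq_some
  · exact H.of_eq_none hwx hyz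
  suffices Kills Z w x u from this hyz
  obtain rfl | hw := eq_or_ne u w
  · exact H.kills_swap (H.kills_self ((third_comm x u).trans hwx))
  obtain rfl | hx := eq_or_ne u x
  · exact H.kills_self hwx
  · exact H.kills_of_ne hwx hw hx

end QuarticRelations

end Separation

section Apart

/-- Some variable of the pair `w, x` and some variable of the pair `y, z` have product zero. -/
def Apart (w x y z : Var m) : Prop :=
  third w y = none ∨ third w z = none ∨ third x y = none ∨ third x z = none

theorem apart_a_b_c [Fact (6 ≤ m)] (k l : ZMod m) (y : Var m) :
    Apart (𝐚 k) (𝐛 (k + 1)) (𝐜 l) y := by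
  have ne_zero := multiples_one_ne_zero (m := m)
  simp only [third, Apart]
  generalize (1 : ZMod m) = e at *
  grind

namespace QuarticRelations

variable {Z : Var m → Var m → Var m → Var m → Prop} [Fact (6 ≤ m)]

theorem of_apart (H : QuarticRelations Z) {w x y z : Var m} (h : Apart w x y z) : Z w x y z := by
  obtain h | h | h | h := h
  · exact H.swap_mid (H.of_third_eq_none h _ _)
  · exact H.swap_right (H.swap_mid (H.of_third_eq_none h _ _))
  · exact H.swap_left (H.swap_mid (H.of_third_eq_none h _ _))
  · exact H.swap_left (H.swap_right (H.swap_mid (H.of_third_eq_none h _ _)))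

theorem of_exchange (H : QuarticRelations Z) {w x y z : Var m} (w' x' y' z' : Var m)
    (h : third w x = third w' x' ∧ third y z = third y' z' ∧ Apart w' x' y z ∧ Apart w x y' z' ∧
      Apart w' x' y' z') : Z w x y z :=
  H.exchange h.1 h.2.1 (H.of_apart h.2.2.1) (H.of_apart h.2.2.2.1) (H.of_apart h.2.2.2.2)

-- In the names below, the letters `s`, `t`, `r` stand for `s`, `s + 1`, `s + 2`, and the indices
-- `i`, `j` for `i`, `i + 1`.

theorem of_ssss (H : QuarticRelations Z) (s : Fin 3) (i : ZMod m) :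
    Z (.inl (s, i)) (.inl (s, i)) (.inl (s, i)) (.inl (s, i)) := by
  have ne_zero := multiples_one_ne_zero (m := m)
  apply H.of_exchange (.inl (s, i - 1)) (.inl (s, i - 1 - 1)) (.inl (s + 1, i - 1))
    (.inl (s + 2, i - 1))
  fin_cases s <;>
  · simp only [third, Apart]
    generalize (1 : ZMod m) = e at *
    grind

theorem of_ssst (H : QuarticRelations Z) (s : Fin 3) (i : ZMod m) :
    Z (.inl (s, i)) (.inl (s, i)) (.inl (s, i)) (.inl (s + 1, i)) := by
  have ne_zero := multiples_one_ne_zero (m := m)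
  apply H.of_exchange (.inl (s, i - 1)) (.inl (s, i - 1 - 1)) (.inl (s + 2, i + 1))
    (.inl (s + 2, i + 1))
  fin_cases s <;>
  · simp only [third, Apart, add_sub_cancel_right]
    generalize (1 : ZMod m) = e at *
    grind (splits := 20)

theorem of_sssr (H : QuarticRelations Z) (s : Fin 3) (i : ZMod m) :
    Z (.inl (s, i)) (.inl (s, i)) (.inl (s, i)) (.inl (s + 2, i)) := by
  have ne_zero := multiples_one_ne_zero (m := m)
  apply H.of_exchange (.inl (s, i - 1)) (.inl (s, i - 1 - 1)) (.inl (s + 1, i))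
    (.inl (s + 1, i - 1))
  fin_cases s <;>
  · simp only [third, Apart]
    generalize (1 : ZMod m) = e at *
    grind

theorem of_stst (H : QuarticRelations Z) (s : Fin 3) (i : ZMod m) :
    Z (.inl (s, i)) (.inl (s + 1, i)) (.inl (s, i)) (.inl (s + 1, i)) := by
  have ne_zero := multiples_one_ne_zero (m := m)
  apply H.of_exchange (.inl (s + 2, i + 1)) (.inl (s + 2, i + 1)) (.inl (s + 2, i))
    (.inl (s + 2, i - 1))
  fin_cases s <;>
  · simp only [third, Apart, add_sub_cancel_right]
    generalize (1 : ZMod m) = e at *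
    grind

theorem of_stsr (H : QuarticRelations Z) (s : Fin 3) (i : ZMod m) :
    Z (.inl (s, i)) (.inl (s + 1, i)) (.inl (s, i)) (.inl (s + 2, i)) := by
  have ne_zero := multiples_one_ne_zero (m := m)
  apply H.of_exchange (.inl (s + 2, i + 1)) (.inl (s + 2, i + 1)) (.inl (s + 1, i))
    (.inl (s + 1, i - 1))
  fin_cases s <;>
  · simp only [third, Apart, add_sub_cancel_right]
    generalize (1 : ZMod m) = e at *
    grind

theorem of_same_index (H : QuarticRelations Z) (s t r r' : Fin 3) (i : ZMod m) :
    Z (.inl (s, i)) (.inl (t, i)) (.inl (r, i)) (.inl (r', i)) := by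
  have repeated (s t r : Fin 3) : Z (.inl (s, i)) (.inl (s, i)) (.inl (t, i)) (.inl (r, i)) := by
    have cyclic (t : Fin 3) : t = s ∨ t = s + 1 ∨ t = s + 2 := by clear H; decide +revert
    obtain rfl | rfl | rfl := cyclic t <;> obtain rfl | rfl | rfl := cyclic r
    · exact H.of_ssss ..
    · exact H.of_ssst ..
    · exact H.of_sssr ..
    · exact H.swap_right (H.of_ssst ..)
    · exact H.swap_mid (H.of_stst ..)
    · exact H.swap_mid (H.of_stsr ..)
    · exact H.swap_right (H.of_sssr ..)
    · exact H.swap_right (H.swap_mid (H.of_stsr ..))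
    · have h := H.of_stst (s + 2) i
      rw [show s + 2 + 1 = s by clear H h; decide +revert] at h
      exact H.swap_mid (H.swap_left (H.swap_right h))
  have : s = t ∨ s = r ∨ s = r' ∨ t = r ∨ t = r' ∨ r = r' := by clear H repeated; decide +revert
  obtain rfl | rfl | rfl | rfl | rfl | rfl := this
  · exact repeated ..
  · exact H.swap_mid (repeated ..)
  · exact H.swap_right (H.swap_mid (repeated ..))
  · exact H.swap_left (H.swap_mid (repeated ..))
  · exact H.swap_left (H.swap_right (H.swap_mid (repeated ..)))
  · exact H.swap_pairs (repeated ..)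

theorem of_iiij (H : QuarticRelations Z) (s : Fin 3) (i : ZMod m) :
    Z (.inl (s, i)) (.inl (s, i)) (.inl (s, i)) (.inl (s, i + 1)) := by
  have ne_zero := multiples_one_ne_zero (m := m)
  apply H.of_exchange (.inl (s, i - 1)) (.inl (s, i - 1 - 1)) (.inl (s, i + 1 + 1))
    (.inl (s, i + 1 + 1))
  simp only [third, Apart, add_sub_cancel_right]
  generalize (1 : ZMod m) = e at *
  grind (splits := 20)

theorem of_ijij (H : QuarticRelations Z) (s : Fin 3) (i : ZMod m) :
    Z (.inl (s, i)) (.inl (s, i + 1)) (.inl (s, i)) (.inl (s, i + 1)) := by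
  have ne_zero := multiples_one_ne_zero (m := m)
  apply H.of_exchange (.inl (s, i + 1 + 1)) (.inl (s, i + 1 + 1)) (.inl (s + 1, i + 1))
    (.inl (s + 2, i + 1))
  fin_cases s <;>
  · simp only [third, Apart, add_sub_cancel_right]
    generalize (1 : ZMod m) = e at *
    grind

theorem of_ijjj (H : QuarticRelations Z) (s : Fin 3) (i : ZMod m) :
    Z (.inl (s, i)) (.inl (s, i + 1)) (.inl (s, i + 1)) (.inl (s, i + 1)) := by
  have ne_zero := multiples_one_ne_zero (m := m)
  have h : third (.inl (s, i)) (.inl (s, i + 1)) =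
        third (.inl (s + 1, i + 1)) (.inl (s + 2, i + 1)) ∧
      third (.inl (s, i + 1)) (.inl (s, i + 1)) = third (.inl (s + 1, i)) (.inl (s + 2, i)) ∧
      Apart (.inl (s, i)) (.inl (s, i + 1)) (.inl (s + 1, i)) (.inl (s + 2, i)) ∧
      Apart (.inl (s + 1, i + 1)) (.inl (s + 2, i + 1)) (.inl (s + 1, i)) (.inl (s + 2, i)) := by
    fin_cases s <;>
    · simp only [third, Apart, add_sub_cancel_right]
      generalize (1 : ZMod m) = e at *
      grind
  exact H.exchange h.1 h.2.1 (H.of_same_index ..) (H.of_apart h.2.2.1) (H.of_apart h.2.2.2)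

theorem of_same_letter (H : QuarticRelations Z) {s : Fin 3} {i₁ i₂ i₃ i₄ i : ZMod m}
    (h₁ : i₁ = i ∨ i₁ = i + 1) (h₂ : i₂ = i ∨ i₂ = i + 1) (h₃ : i₃ = i ∨ i₃ = i + 1)
    (h₄ : i₄ = i ∨ i₄ = i + 1) :
    Z (.inl (s, i₁)) (.inl (s, i₂)) (.inl (s, i₃)) (.inl (s, i₄)) := by
  have h := H.of_same_index s s s s
  have h_iiij := H.of_iiij s i
  have h_ijij := H.of_ijij s i
  have h_ijjj := H.of_ijjj s i
  have swap_left := @H.swap_left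
  have swap_mid := @H.swap_mid
  have swap_right := @H.swap_right
  grind

end QuarticRelations

end Apart

section Adjacent

/-- The product `x * y` does not vanish modulo `Ann(F')` and does not determine `d`. For two
variables other than `d`, this relates equal indices, and neighbouring indices of the same
letter. -/
def Adj (x y : Var m) : Prop := third x y ≠ none ∧ third x y ≠ some 𝐝

theorem adj_iff {s t : Fin 3} {i j : ZMod m} : Adj (.inl (s, i)) (.inl (t, j)) ↔
    i = j ∨ s = t ∧ (j = i + 1 ∨ i = j + 1) := by
  simp only [Adj, third]
  grind

theorem exists_third_c_eq_of_adj {x y : Fin 3 × ZMod m} (hx : x.1 ≠ 2) (h : Adj (.inl x) (.inl y)) :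
    ∃ l z, third (.inl x) (.inl y) = third (𝐜 l) z ∧ (l = x.2 - 1 ∨ l = x.2 ∨ l = x.2 + 1) := by
  rcases hxy : third (.inl x) (.inl y) with _ | ⟨t, l⟩ | ⟨⟨⟩⟩
  · exact absurd hxy h.1
  · obtain ⟨z, hz⟩ := exists_third_c_eq t l
    refine ⟨_, z, hz.symm, ?_⟩
    obtain ⟨r, i⟩ := x
    obtain ⟨s, j⟩ := y
    have := adj_iff.1 h
    simp only [third] at hxy
    grind
  · exact absurd hxy h.2

theorem exists_of_adj_d {x : Var m} (h : Adj 𝐝 x) :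
    ∃ x' : Fin 3 × ZMod m, x'.1 ≠ 2 ∧ x = .inl x' := by
  rcases x with x | ⟨⟨⟩⟩
  · exact ⟨x, mt third_d_left_eq_none_iff.2 h.1, rfl⟩
  · exact absurd rfl h.1

namespace QuarticRelations

variable {Z : Var m → Var m → Var m → Var m → Prop} [Fact (6 ≤ m)]

theorem of_a_b_succ (H : QuarticRelations Z) (i : ZMod m) (y z : Var m) :
    Z (𝐚 i) (𝐛 (i + 1)) y z := by
  wlog hy : ∃ y', y = .inl y' generalizing y z
  · rcases z with z' | ⟨⟨⟩⟩
    · exact H.swap_right (this _ _ ⟨z', rfl⟩)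
    · obtain rfl : y = 𝐝 := by aesop
      exact H.swap_pairs (H.of_third_eq_none rfl _ _)
  obtain ⟨y, rfl⟩ := hy
  obtain ⟨k, hk⟩ := exists_third_a_eq_none y
  rcases hyz : third (.inl y) z with _ | ⟨t, l⟩ | ⟨⟨⟩⟩
  · exact H.swap_pairs (H.of_third_eq_none hyz _ _)
  · obtain ⟨y', hu⟩ := exists_third_c_eq t l
    exact H.of_exchange (𝐚 k) (𝐛 (k + 1)) _ y' ⟨(third_a_b_succ i).trans (third_a_b_succ k).symm,
      hyz.trans hu.symm, .inl hk, apart_a_b_c .., apart_a_b_c ..⟩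
  · obtain ⟨j, hj⟩ := exists_ne_of_five i (i - 1) k (k - 1) 0
    refine H.of_exchange (𝐚 k) (𝐛 (k + 1)) (𝐚 j) (𝐛 (j + 1))
      ⟨(third_a_b_succ i).trans (third_a_b_succ k).symm, hyz.trans (third_a_b_succ j).symm, .inl hk,
        .inr (.inl ?_), .inr (.inl ?_)⟩ <;>
    · rw [third_a_b_eq_none_iff]
      grind

theorem of_third_eq_d (H : QuarticRelations Z) {w x : Var m} (h : third w x = some 𝐝)
    (y z : Var m) : Z w x y z := by
  obtain ⟨i, ⟨rfl, rfl⟩ | ⟨rfl, rfl⟩⟩ := eq_or_eq_of_third_eq_d h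
  · exact H.of_a_b_succ i y z
  · exact H.swap_left (H.of_a_b_succ i y z)

theorem of_d_a (H : QuarticRelations Z) {j : ZMod m} {y z : Fin 3 × ZMod m}
    (hjy : Adj (𝐚 j) (.inl y)) (hyz : Adj (.inl y) (.inl z)) (hy : y.1 ≠ 2) (hy' : y ≠ (0, j + 1)) :
    Z 𝐝 (𝐚 j) (.inl y) (.inl z) := by
  have ne_zero := multiples_one_ne_zero (m := m)
  obtain ⟨l, y', h, hl⟩ := exists_third_c_eq_of_adj hy hyz
  have hjy := adj_iff.1 hjy
  refine H.of_exchange (𝐛 (j + 1 + 1)) (𝐛 (j + 1 + 1)) (𝐜 l) y'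
    ⟨(third_a_d j).trans (third_self 1 (j + 1)).symm, h, .inl ?_, .inl rfl, .inl ?_⟩
  · obtain ⟨s, i⟩ := y
    clear h
    simp only [third] at *
    generalize (1 : ZMod m) = e at *
    grind
  · rw [third_c_right_eq_none_iff (by simp)]
    clear h
    generalize (1 : ZMod m) = e at *
    grind

theorem of_d_b (H : QuarticRelations Z) {j : ZMod m} {y z : Fin 3 × ZMod m}
    (hjy : Adj (𝐛 (j + 1)) (.inl y)) (hyz : Adj (.inl y) (.inl z)) (hy : y.1 ≠ 2)
    (hy' : y ≠ (1, j)) : Z 𝐝 (𝐛 (j + 1)) (.inl y) (.inl z) := by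
  have ne_zero := multiples_one_ne_zero (m := m)
  obtain ⟨l, y', h, hl⟩ := exists_third_c_eq_of_adj hy hyz
  have hjy := adj_iff.1 hjy
  refine H.of_exchange (𝐚 j) (𝐚 (j - 1)) (𝐜 l) y'
    ⟨(third_d_b_succ j).trans ?_, h, .inr (.inr (.inl ?_)), .inl rfl, ?_⟩
  · grind [third]
  · obtain ⟨s, i⟩ := y
    clear h
    simp only [third] at *
    generalize (1 : ZMod m) = e at *
    grind
  · clear h
    simp only [third, Apart]
    generalize (1 : ZMod m) = e at *
    grind

theorem of_d (H : QuarticRelations Z) {x y z : Fin 3 × ZMod m} (hx : x.1 ≠ 2) (hy : y.1 ≠ 2)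
    (hz : z.1 ≠ 2) (hxy : Adj (.inl x) (.inl y)) (hxz : Adj (.inl x) (.inl z))
    (hyz : Adj (.inl y) (.inl z)) : Z 𝐝 (.inl x) (.inl y) (.inl z) := by
  have symm {x y : Fin 3 × ZMod m} (h : Adj (.inl x) (.inl y)) : Adj (.inl y) (.inl x) := by
    rwa [Adj, third_comm]
  have hone : (1 : ZMod m) ≠ 0 ∧ (1 + 1 : ZMod m) ≠ 0 :=
    ⟨multiples_one_ne_zero.1, multiples_one_ne_zero.2.1⟩
  obtain ⟨s, j⟩ := x
  have hs : s = 0 ∨ s = 1 := by clear hxy hxz; grind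
  obtain rfl | rfl := hs
  · by_cases hy' : y = (0, j + 1)
    · by_cases hz' : z = (0, j + 1)
      · subst hy' hz'
        refine H.swap_mid (H.of_d_a (symm hxy) hxy hx ?_)
        simpa [add_assoc] using hone.2
      · exact H.swap_right (H.of_d_a hxz (symm hyz) hz hz')
    · exact H.of_d_a hxy hyz hy hy'
  · obtain ⟨i, rfl⟩ : ∃ i, j = i + 1 + 1 := ⟨j - 1 - 1, by simp⟩
    by_cases hy' : y = (1, i + 1)
    · by_cases hz' : z = (1, i + 1)
      · subst hy' hz'
        refine H.swap_mid (H.of_d_b (symm hxy) hxy hx ?_)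
        simpa [add_assoc] using hone.2
      · exact H.swap_right (H.of_d_b hxz (symm hyz) hz hz')
    · exact H.of_d_b hxy hyz hy hy'

theorem of_adj (H : QuarticRelations Z) {w x y z : Fin 3 × ZMod m} (hwx : Adj (.inl w) (.inl x))
    (hwy : Adj (.inl w) (.inl y)) (hwz : Adj (.inl w) (.inl z)) (hxy : Adj (.inl x) (.inl y))
    (hxz : Adj (.inl x) (.inl z)) (hyz : Adj (.inl y) (.inl z)) :
    Z (.inl w) (.inl x) (.inl y) (.inl z) := by
  obtain ⟨s₁, i₁⟩ := w
  obtain ⟨s₂, i₂⟩ := x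
  obtain ⟨s₃, i₃⟩ := y
  obtain ⟨s₄, i₄⟩ := z
  simp only [adj_iff] at *
  by_cases hi : i₂ = i₁ ∧ i₃ = i₁ ∧ i₄ = i₁
  · obtain ⟨rfl, rfl, rfl⟩ := hi
    exact H.of_same_index ..
  · have hs : s₂ = s₁ ∧ s₃ = s₁ ∧ s₄ = s₁ := by clear H; grind
    obtain ⟨rfl, rfl, rfl⟩ := hs
    have ne_zero := multiples_one_ne_zero (m := m)
    obtain ⟨i, h₁, h₂, h₃, h₄⟩ : ∃ i, (i₁ = i ∨ i₁ = i + 1) ∧ (i₂ = i ∨ i₂ = i + 1) ∧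
        (i₃ = i ∨ i₃ = i + 1) ∧ (i₄ = i ∨ i₄ = i + 1) := by
      clear H
      generalize (1 : ZMod m) = e at *
      by_cases h : i₂ = i₁ + e ∨ i₃ = i₁ + e ∨ i₄ = i₁ + e
      · use i₁
        grind
      · use i₁ - e
        grind
    exact H.of_same_letter h₁ h₂ h₃ h₄

theorem adj_of_not (H : QuarticRelations Z) {w x y z : Var m} (h : ¬ Z w x y z) : Adj w x :=
  ⟨fun h₀ ↦ h (H.of_third_eq_none h₀ _ _), fun hd ↦ h (H.of_third_eq_d hd y z)⟩

theorem all_d (H : QuarticRelations Z) (x y z : Var m) : Z 𝐝 x y z := by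
  by_contra h
  obtain ⟨x, hx, rfl⟩ := exists_of_adj_d (H.adj_of_not h)
  obtain ⟨y, hy, rfl⟩ := exists_of_adj_d (H.adj_of_not (mt H.swap_mid h))
  obtain ⟨z, hz, rfl⟩ := exists_of_adj_d (H.adj_of_not (mt (H.swap_right ∘ H.swap_mid) h))
  exact h (H.of_d hx hy hz (H.adj_of_not (mt (H.swap_left ∘ H.swap_mid) h))
    (H.adj_of_not (mt (H.swap_right ∘ H.swap_left ∘ H.swap_mid) h))
    (H.adj_of_not (mt H.swap_pairs h)))

theorem all (H : QuarticRelations Z) (w x y z : Var m) : Z w x y z := by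
  by_contra h
  rcases w with w | ⟨⟨⟩⟩
  · rcases x with x | ⟨⟨⟩⟩
    · rcases y with y | ⟨⟨⟩⟩
      · rcases z with z | ⟨⟨⟩⟩
        · exact h (H.of_adj (H.adj_of_not h) (H.adj_of_not (mt H.swap_mid h))
            (H.adj_of_not (mt (H.swap_right ∘ H.swap_mid) h))
            (H.adj_of_not (mt (H.swap_left ∘ H.swap_mid) h))
            (H.adj_of_not (mt (H.swap_right ∘ H.swap_left ∘ H.swap_mid) h))
            (H.adj_of_not (mt H.swap_pairs h)))
        · exact h (H.swap_right (H.swap_mid (H.swap_left (H.all_d ..))))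
      · exact h (H.swap_mid (H.swap_left (H.all_d ..)))
    · exact h (H.swap_left (H.all_d ..))
  · exact h (H.all_d ..)

end QuarticRelations

end Adjacent

section SquaredIdeal

variable {k : Type*} [Field k]

/-- The quartic `w aⱼ bⱼ cⱼ`. For an index `j` different from that of `w`, it is independent of `j`
modulo `Ann(F')²`, and these quartics form a basis of the degree `4` part of `S' / Ann(F')²`. -/
noncomputable def quartic (k : Type*) [Field k] (w : Var m) (j : ZMod m) : MvPolynomial (Var m) k :=
  X w * X (𝐚 j) * (X (𝐛 j) * X (𝐜 j))

theorem isHomogeneous_quartic (w : Var m) (j : ZMod m) : (quartic k w j).IsHomogeneous 4 :=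
  (isHomogeneous_X_mul_X _ _).mul (isHomogeneous_X_mul_X _ _)

variable [NeZero m] [Fact (6 ≤ m)]

theorem apply_pderiv_quartic (v : Var m) {w : Var m} {j : ZMod m} (hw : ∀ t, w ≠ .inl (t, j)) :
    (dualElement (cubicF' k m)).1 (pderiv v (quartic k w j)) = if v = w then 1 else 0 := by
  have apply (x u y z : Var m) :
      (dualElement (cubicF' k m)).1 (pderiv v (X x) * (X u * (X y * X z))) =
        if v = x ∧ third y z = some u then 1 else 0 := by
    obtain rfl | hvx := eq_or_ne v x
    · simp [(hasProductTable_cubicF' k).apply]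
    · simp [pderiv_X_of_ne hvx.symm, hvx]
  have expand : pderiv v (quartic k w j) =
      pderiv v (X w) * (X (𝐚 j) * (X (𝐛 j) * X (𝐜 j))) +
        pderiv v (X (𝐚 j)) * (X w * (X (𝐛 j) * X (𝐜 j))) +
        pderiv v (X (𝐛 j)) * (X w * (X (𝐚 j) * X (𝐜 j))) +
        pderiv v (X (𝐜 j)) * (X w * (X (𝐚 j) * X (𝐛 j))) := by
    simp only [quartic, Derivation.leibniz, smul_eq_mul]
    ring
  simp only [expand, map_add, apply, third_a_b, third_a_c, third_b_c]
  simp [(hw _).symm]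

theorem quarticRelations {N : Submodule k (MvPolynomial (Var m) k)}
    (hN : ((Ann (dualElement (cubicF' k m))) ^ 2).restrictScalars k ≤ N)
    (hquartic : ∀ w : Var m, ∃ j, (∀ t, w ≠ .inl (t, j)) ∧ quartic k w j ∈ N) :
    QuarticRelations fun w x y z : Var m ↦ X w * X x * (X y * X z) ∈ N := by
  have hf := hasProductTable_cubicF' (m := m) k
  have mul_mem {p q} (hp : p ∈ Ann (dualElement (cubicF' k m)))
      (hq : q ∈ Ann (dualElement (cubicF' k m))) : p * q ∈ N :=
    hN (pow_two (Ann (dualElement (cubicF' k m))) ▸ Ideal.mul_mem_mul hp hq)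
  exact
    { swap_left := fun h ↦ by convert h using 1; ring
      swap_mid := fun h ↦ by convert h using 1; ring
      swap_right := fun h ↦ by convert h using 1; ring
      of_eq_none := fun hwx hyz ↦ mul_mem (hf.X_mul_X_mem_Ann hwx) (hf.X_mul_X_mem_Ann hyz)
      congr := fun hwx hyz h ↦ by
        have := mul_mem (hf.X_mul_X_mem_Ann hwx) (hf.X_mul_X_sub_mem_Ann hyz)
        rw [mul_sub] at this
        exact (N.sub_mem_iff_left h).1 this
      exchange := fun {w x y z w' x' y' z'} hwx hyz h₁ h₂ h₃ ↦ by
        have := mul_mem (hf.X_mul_X_sub_mem_Ann hwx) (hf.X_mul_X_sub_mem_Ann hyz)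
        convert N.add_mem this (N.sub_mem (N.add_mem h₁ h₂) h₃) using 1
        ring
      base := hquartic }

theorem homogeneousSubmodule_four_le_of_quartic_mem {N : Submodule k (MvPolynomial (Var m) k)}
    (hN : ((Ann (dualElement (cubicF' k m))) ^ 2).restrictScalars k ≤ N)
    (hquartic : ∀ w : Var m, ∃ j, (∀ t, w ≠ .inl (t, j)) ∧ quartic k w j ∈ N) :
    homogeneousSubmodule (Var m) k 4 ≤ N :=
  homogeneousSubmodule_four_le (quarticRelations hN hquartic).all

theorem hilbertFunction_Ann_sq_four :
    hilbertFunction ((Ann (dualElement (cubicF' k m))) ^ 2) 4 = Fintype.card (Var m) := by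
  have exists_index (w : Var m) : ∃ j, ∀ t, w ≠ .inl (t, j) := by
    rcases w with ⟨s, i⟩ | ⟨⟩
    · exact ⟨i + 1, by simp [multiples_one_ne_zero.1]⟩
    · exact ⟨0, by simp⟩
  choose j hj using exists_index
  refine hilbertFunction_eq_card (p := fun w ↦ quartic k w (j w))
    (fun w ↦ isHomogeneous_quartic w (j w))
    (homogeneousSubmodule_four_le_of_quartic_mem le_sup_left fun w ↦
      ⟨j w, hj w, Submodule.mem_sup_right (Submodule.subset_span ⟨w, rfl⟩)⟩)
    (φ := fun v ↦ (dualElement (cubicF' k m)).1 ∘ₗ (pderiv v).toLinearMap)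
    (fun v q hq ↦ apply_pderiv_eq_zero_of_mem_sq hq v) fun v w ↦ apply_pderiv_quartic v (hj w)

theorem X_mul_quartic_mem_Ann_sq {v w : Var m} {j : ZMod m} (hv : ∀ t, v ≠ .inl (t, j))
    (hw : ∀ t, w ≠ .inl (t, j)) :
    X v * quartic k w j ∈ Ann (dualElement (cubicF' k m)) ^ 2 := by
  have hf := hasProductTable_cubicF' (m := m) k
  rw [pow_two]
  obtain h | h : third v (𝐚 j) = none ∨ third v (𝐜 j) = none := by
    rcases v with ⟨t, i⟩ | ⟨⟩
    · have hij : j ≠ i := fun h ↦ hv t (h ▸ rfl)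
      obtain rfl | ht := eq_or_ne t 2
      · exact .inl ((third_c_left_eq_none_iff (by simp)).2 hij)
      · exact .inr ((third_c_right_eq_none_iff ht).2 hij)
    · exact .inr (third_d_left_eq_none_iff.2 rfl)
  · have hcubic := hf.X_mul_X_mul_X_mem_Ann (x := w) (y := 𝐛 j) (z := 𝐜 j)
      (by simpa [third_b_c] using (hw 0).symm)
    convert Ideal.mul_mem_mul (hf.X_mul_X_mem_Ann h) hcubic using 1
    rw [quartic]
    ring
  · have hcubic := hf.X_mul_X_mul_X_mem_Ann (x := w) (y := 𝐚 j) (z := 𝐛 j)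
      (by simpa [third_a_b] using (hw 2).symm)
    convert Ideal.mul_mem_mul (hf.X_mul_X_mem_Ann h) hcubic using 1
    rw [quartic]
    ring

theorem hilbertFunction_Ann_sq_five :
    hilbertFunction ((Ann (dualElement (cubicF' k m))) ^ 2) 5 = 0 := by
  refine hilbertFunction_eq_zero (homogeneousSubmodule_succ_le fun v ↦ ?_)
  let N := (((Ann (dualElement (cubicF' k m))) ^ 2).restrictScalars k).comap
    (LinearMap.mulLeft k (X v))
  refine homogeneousSubmodule_four_le_of_quartic_mem (N := N)
    (fun p hp ↦ Ideal.mul_mem_left _ _ hp) fun w ↦ ?_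
  have index (u : Var m) : ∃ i, ∀ j, j ≠ i → ∀ t, u ≠ .inl (t, j) := by
    rcases u with ⟨s, i⟩ | ⟨⟩
    · exact ⟨i, fun j hj t h ↦ hj (by cases h; rfl)⟩
    · exact ⟨0, by simp⟩
  obtain ⟨i, hv⟩ := index v
  obtain ⟨i', hw⟩ := index w
  obtain ⟨j, hj, hj', -⟩ := exists_ne_of_five i i' i i i
  exact ⟨j, hw j hj', X_mul_quartic_mem_Ann_sq (hv j hj) (hw j hj')⟩

end SquaredIdeal

end SmallTangent

theorem mainTheorem5 {k : Type*} [Field k] (m : ℕ) [NeZero m] (hm : 6 ≤ m) :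
    Fintype.card (SmallTangent.Var m) = 3 * m + 1 ∧
      SmallTangent.SmallTangentSpaceCondition
        (SmallTangent.dualElement (SmallTangent.cubicF' k m)) := by
  have := Fact.mk hm
  have hF := SmallTangent.hasProductTable_cubicF' (m := m) k
  exact ⟨by simp [ZMod.card],
    { homogeneous := hF.homogeneous
      hilbert_zero := hF.hilbertFunction_zero_three.1
      hilbert_one := hF.hilbertFunction_one_two.1
      hilbert_two := hF.hilbertFunction_one_two.2
      hilbert_three := hF.hilbertFunction_zero_three.2
      hilbert_ge_four := fun _ ↦ hF.hilbertFunction_of_four_le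
      hilbert_sq_four := SmallTangent.hilbertFunction_Ann_sq_four
      hilbert_sq_five := SmallTangent.hilbertFunction_Ann_sq_five }⟩
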